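/- Let $v$, $q$, $\rho$ be natural numbers. A \emph{difference system of sets} (DSS) of index $\rho$ on $q$ sets over $\mathbb{Z}_v$ is a family of pairwise disjoint subsets $Q_0,\dots,Q_{q-1}$ of $\mathbb{Z}_v$ such that the multiset $\{a-b \bmod v : a\in Q_i,\ b\in Q_j,\ i\ne j\}$ contains every $d\in\mathbb{Z}_v\setminus\{0\}$ at least $\rho$ times. It is \emph{perfect} if every such $d$ occurs exactly $\rho$ times, and a perfect DSS all of whose $q$ sets have size $m$ is called a perfect regular $\mathrm{DSS}(v,m,q,\rho)$. The \emph{redundancy} of a DSS is $|Q_0\cup\dots\cup Q_{q-1}|$, its \emph{redundancy rate} is the redundancy divided by $v$, and a DSS of index $\rho$ is \emph{optimal} if its redundancy is the smallest among all DSSs of index $\rho$ on $q$ sets over $\mathbb{Z}_v$. \textbf{Theorem.} Let $n$ be a natural number such that $p=108n^2+1$ is prime. Then there exists a perfect regular $\mathrm{DSS}(108n^2+1,\,18n^2,\,2,\,6n^2)$. More precisely, for every primitive element $\alpha$ of $\mathbb{F}_p$, the cyclotomic classes $C_i^6=\{\alpha^{i+6t} : 0\le t\le 18n^2-1\}$ with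 $i=0$ and $i=3$ form a perfect regular $\mathrm{DSS}(108n^2+1,\,18n^2,\,2,\,6n^2)$. This DSS is optimal, and its redundancy rate is $$\frac{36n^2}{108n^2+1}=\frac13-\frac{1}{3(108n^2+1)}.$$ -/

import Mathlib

namespace DiffSystemOfSets

/-- The multiset `{a - b mod v : a ∈ Q i, b ∈ Q j, i ≠ j}` of outer differences, over all ordered
pairs `(i, j)` of distinct indices. -/
def outerDifferences {v q : ℕ} (Q : Fin q → Finset (ZMod v)) : Multiset (ZMod v) :=
  (Finset.univ.filter (fun ij : Fin q × Fin q => ij.1 ≠ ij.2)).val.bind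
    (fun ij => (Q ij.1 ×ˢ Q ij.2).val.map (fun ab => ab.1 - ab.2))

/-- `Q` is a difference system of sets of index `ρ` on `q` sets over `ℤ/v`. -/
structure IsDSS {v q : ℕ} (ρ : ℕ) (Q : Fin q → Finset (ZMod v)) : Prop where
  disjoint : ∀ i j, i ≠ j → Disjoint (Q i) (Q j)
  le_count : ∀ d : ZMod v, d ≠ 0 → ρ ≤ (outerDifferences Q).count d

/-- `Q` is a perfect difference system of sets of index `ρ`: every nonzero residue is an outer
difference exactly `ρ` times. -/
structure IsPerfectDSS {v q : ℕ} (ρ : ℕ) (Q : Fin q → Finset (ZMod v)) : Prop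
    extends IsDSS ρ Q where
  count_eq : ∀ d : ZMod v, d ≠ 0 → (outerDifferences Q).count d = ρ

/-- `Q` is a perfect regular DSS`(v, m, q, ρ)`. -/
structure IsPerfectRegularDSS (v m q ρ : ℕ) (Q : Fin q → Finset (ZMod v)) : Prop
    extends IsPerfectDSS ρ Q where
  card_eq : ∀ i, (Q i).card = m

/-- The redundancy `|Q 0 ∪ ⋯ ∪ Q (q - 1)|`. -/
def redundancy {v q : ℕ} (Q : Fin q → Finset (ZMod v)) : ℕ :=
  (Finset.univ.biUnion Q).card

/-- The redundancy rate: the proportion of the `v` positions used by the system. -/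
def redundancyRate {v q : ℕ} (Q : Fin q → Finset (ZMod v)) : ℚ :=
  (redundancy Q : ℚ) / (v : ℚ)

/-- `Q` is a difference system of sets of index `ρ` whose redundancy is the least among all
difference systems of sets with the same `v`, `q` and `ρ`. -/
structure IsOptimalDSS {v q : ℕ} (ρ : ℕ) (Q : Fin q → Finset (ZMod v)) : Prop
    extends IsDSS ρ Q where
  redundancy_le : ∀ Q' : Fin q → Finset (ZMod v), IsDSS ρ Q' → redundancy Q ≤ redundancy Q'

/-- The cyclotomic class `C_i^f = {α ^ (i + t f) : 0 ≤ t ≤ m - 1}` in `𝔽_p`, where `p = f m + 1`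
and `α` is a primitive element. -/
def cyclotomicClass {p : ℕ} (α : (ZMod p)ˣ) (f i : ℕ) : Finset (ZMod p) :=
  (Finset.range ((p - 1) / f)).image (fun t => (α : ZMod p) ^ (i + t * f))

end DiffSystemOfSets

/-! Let `χ` be a cubic and `η` the quadratic character of `𝔽_p`. The indicators of `C_0^6` and
`C_3^6` are `(1 + χ + χ⁻¹)(1 ± η) / 6`, so the multiplicity of a difference `d` is a combination of
sextic Jacobi sums. If `χ 4 = 1`, these all reduce to `J = J(χ, χ)` and its conjugate, and 18 times
the multiplicity is `p - 1 - (χ d + χ⁻¹ d)(J + star J + 2)`. It remains to see that `χ 4 = 1` and `J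
+ star J = -2` (`apply_four_eq_one_and_jacobiSum_add`). As `p = 1 + 27 (2n)²`, uniqueness of `4p =
L² + 27M²` forces `L = ±2` for `L = J + star J`; a congruence modulo 3 gives the sign, and a
congruence modulo 2 gives `χ 4 = 1`. Optimality is the AM-GM inequality applied to the number of
differences. -/

namespace MulChar

/-! ### Quadratic character and Jacobi sum identities -/

variable {F R : Type*} [Field F] [Fintype F] [DecidableEq F] [CommRing R]

/-- The quadratic character of a finite field, with values in an arbitrary ring. -/
def quadratic (F R : Type*) [Field F] [Fintype F] [DecidableEq F] [CommRing R] : MulChar F R :=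
  (quadraticChar F).ringHomComp (Int.castRingHom R)

lemma quadratic_apply (x : F) : quadratic F R x = (quadraticChar F x : R) := rfl

lemma quadratic_mul_self : quadratic F R * quadratic F R = 1 := by
  rw [← sq]
  exact ((quadraticChar_isQuadratic F).comp _).sq_eq_one

lemma quadratic_inv : (quadratic F R)⁻¹ = quadratic F R :=
  inv_eq_of_mul_eq_one_right quadratic_mul_self

lemma quadratic_apply_sq {x : F} (hx : x ≠ 0) : quadratic F R (x ^ 2) = 1 := by
  rw [quadratic_apply, quadraticChar_sq_one' hx, Int.cast_one]

/-- Summing a function of the square, weighted by the number of square roots. -/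
lemma sum_comp_sq (hF : ringChar F ≠ 2) (f : F → R) :
    ∑ x : F, f (x ^ 2) = ∑ u : F, (quadratic F R u + 1) * f u := by
  classical
  rw [← Finset.sum_fiberwise (Finset.univ : Finset F) (fun x => x ^ 2)]
  refine Finset.sum_congr rfl fun u _ => ?_
  have h := quadraticChar_card_sqrts hF u
  have h' : ((Finset.univ.filter fun x : F => x ^ 2 = u).card : R) = quadratic F R u + 1 := by
    rw [quadratic_apply]
    have : (Finset.univ.filter fun x : F => x ^ 2 = u) = {x : F | x ^ 2 = u}.toFinset := by
      ext; simp
    rw [this]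
    exact_mod_cast congrArg (Int.cast : ℤ → R) h
  rw [← h', ← nsmul_eq_mul, ← Finset.sum_const]
  exact Finset.sum_congr rfl fun x hx => by rw [(Finset.mem_filter.mp hx).2]

/-- The duplication formula `χ(4) J(χ, χ) = J(χ, η)` for the quadratic character `η`. -/
lemma apply_four_mul_jacobiSum_self [IsDomain R] (hF : ringChar F ≠ 2) {χ : MulChar F R}
    (hχ : χ ≠ 1) : χ 4 * jacobiSum χ χ = jacobiSum χ (quadratic F R) := by
  have h2 : (2 : F) ≠ 0 := Ring.two_ne_zero hF
  have h1 : χ 4 * jacobiSum χ χ = ∑ x : F, χ (1 - x ^ 2) := by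
    rw [jacobiSum, Finset.mul_sum]
    -- Completing the square: `4x(1 - x) = 1 - (2x - 1)²`.
    let e : F ≃ F := (Equiv.mulLeft₀ 2 h2).trans (Equiv.subRight 1)
    rw [← e.sum_comp fun x => χ (1 - x ^ 2)]
    refine Finset.sum_congr rfl fun x _ => ?_
    rw [← map_mul, ← map_mul]
    congr 1
    simp only [e, Equiv.trans_apply, Equiv.mulLeft₀_apply, Equiv.subRight_apply]
    ring
  have h0 : ∑ u : F, χ (1 - u) = 0 := by
    rw [← sum_eq_zero_of_ne_one hχ]
    exact (Equiv.subLeft (1 : F)).sum_comp χ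
  rw [h1, sum_comp_sq hF (fun u => χ (1 - u)), jacobiSum_comm, jacobiSum]
  simp only [add_mul, one_mul, Finset.sum_add_distrib, h0, add_zero]

omit [DecidableEq F] in
/-- The effect on a Jacobi sum of inverting the variable. -/
lemma jacobiSum_eq_apply_neg_one_mul (χ ψ : MulChar F R) :
    jacobiSum χ ψ = ψ (-1) * jacobiSum (χ * ψ)⁻¹ ψ := by
  rw [jacobiSum, jacobiSum, ← Equiv.sum_comp (Equiv.inv F), Finset.mul_sum]
  refine Finset.sum_congr rfl fun x _ => ?_
  rcases eq_or_ne x 0 with rfl | hx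
  · simp
  have h : ψ (1 - x⁻¹) = ψ (-1) * ψ x⁻¹ * ψ (1 - x) := by
    rw [← map_mul, ← map_mul]
    congr 1
    field_simp
    ring
  simp only [Equiv.inv_apply, h, inv_apply', mul_apply]
  ring

-- The substitution `x ↦ -d x` turns a correlation with shift `d` into a Jacobi sum.
omit [DecidableEq F] in
lemma sum_apply_mul_apply_add (χ ψ : MulChar F R) {d : F} (hd : d ≠ 0) :
    ∑ x : F, χ x * ψ (x + d) = χ (-1) * (χ d * ψ d) * jacobiSum χ ψ := by
  rw [jacobiSum, Finset.mul_sum, 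
    ← Equiv.sum_comp (Equiv.mulLeft₀ (-d) (neg_ne_zero.mpr hd))]
  refine Finset.sum_congr rfl fun x _ => ?_
  have h1 : -d * x = -1 * d * x := by ring
  have h2 : -1 * d * x + d = d * (1 - x) := by ring
  simp only [Equiv.mulLeft₀_apply, h1, h2, map_mul]
  ring

end MulChar

/-! ### The form `L² + 27M²` -/

/-- Uniqueness of the representation `4 p = L ^ 2 + 27 M ^ 2` when `p = 1 + 27 N ^ 2`. -/
lemma sq_eq_four_of_sq_add_twentyseven_mul_sq {p L M N : ℤ} (hp : Prime p) (hp0 : 0 < p)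
    (hN : p = 1 + 27 * N ^ 2) (h : 4 * p = L ^ 2 + 27 * M ^ 2) : L ^ 2 = 4 := by
  have key : ∀ M : ℤ, 4 * p = L ^ 2 + 27 * M ^ 2 → p ∣ L * N - M → L ^ 2 = 4 := by
    rintro M h ⟨t, ht⟩
    -- Composition of the two representations. The second square is divisible by `p²`, so size
    -- forces `t = 0`, that is `M = L N`.
    have h1 : 4 * p * p = (L + 27 * M * N) ^ 2 + 27 * (p * t) ^ 2 := by
      rw [← ht, h]
      nth_rewrite 1 [hN]
      ring
    have h2 : 27 * t ^ 2 ≤ 4 := by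
      have : 27 * t ^ 2 * (p * p) ≤ 4 * (p * p) := by nlinarith [sq_nonneg (L + 27 * M * N)]
      exact le_of_mul_le_mul_right this (by positivity)
    have h3 : t = 0 := by
      by_contra h0
      have := Int.one_le_abs h0
      nlinarith [sq_abs t]
    have h4 : M = L * N := by rw [h3] at ht; linarith
    have h5 : 4 * p = L ^ 2 * p := by
      rw [h, h4, hN]
      ring
    exact (mul_right_cancel₀ hp0.ne' h5).symm
  have hdvd : p ∣ (L * N - M) * (L * N + M) :=
    ⟨4 * N ^ 2 - M ^ 2, by
      have : L ^ 2 = 4 * p - 27 * M ^ 2 := by linarith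
      have e : (L * N - M) * (L * N + M) = L ^ 2 * N ^ 2 - M ^ 2 := by ring
      rw [e, this]
      linear_combination (M ^ 2) * hN⟩
  rcases hp.dvd_or_dvd hdvd with h' | h'
  · exact key M h h'
  · exact key (-M) (by rw [neg_sq]; exact h) (by rwa [sub_neg_eq_add])

/-! ### Coordinates in `ℤ[ζ]` for a primitive cube root of unity `ζ` -/

section Eisenstein

variable {ζ : ℂ}

lemma IsPrimitiveRoot.sq_add_add_one_eq_zero (hζ : IsPrimitiveRoot ζ 3) : ζ ^ 2 + ζ + 1 = 0 := by
  have h := hζ.geom_sum_eq_zero (by norm_num)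
  simp only [Finset.sum_range_succ, Finset.sum_range_zero] at h
  linear_combination h

lemma IsPrimitiveRoot.mem_adjoin_iff_exists_int (hζ : IsPrimitiveRoot ζ 3) {z : ℂ}
    (hz : z ∈ Algebra.adjoin ℤ {ζ}) : ∃ a b : ℤ, z = a + b * ζ := by
  have hs := hζ.sq_add_add_one_eq_zero
  induction hz using Algebra.adjoin_induction with
  | mem x hx => exact ⟨0, 1, by rw [Set.mem_singleton_iff.mp hx]; simp⟩
  | algebraMap r => exact ⟨r, 0, by simp⟩
  | add x y _ _ hx hy =>
    obtain ⟨a, b, rfl⟩ := hx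
    obtain ⟨c, d, rfl⟩ := hy
    exact ⟨a + c, b + d, by push_cast; ring⟩
  | mul x y _ _ hx hy =>
    obtain ⟨a, b, rfl⟩ := hx
    obtain ⟨c, d, rfl⟩ := hy
    exact ⟨a * c - b * d, a * d + b * c - b * d, by push_cast; linear_combination b * d * hs⟩

lemma IsPrimitiveRoot.conj_eq_sq (hζ : IsPrimitiveRoot ζ 3) : star ζ = ζ ^ 2 := by
  have h1 : star ζ = ζ⁻¹ := (Complex.inv_eq_conj (hζ.norm'_eq_one (by norm_num))).symm
  rw [h1, inv_eq_iff_eq_inv, eq_comm, inv_eq_of_mul_eq_one_left]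
  rw [← hζ.pow_eq_one]
  ring

lemma IsPrimitiveRoot.int_add_int_mul_inj (hζ : IsPrimitiveRoot ζ 3) {a b c d : ℤ}
    (h : (a : ℂ) + b * ζ = c + d * ζ) : a = c ∧ b = d := by
  have hs := hζ.sq_add_add_one_eq_zero
  have h' := congrArg star h
  simp only [star_add, star_mul', hζ.conj_eq_sq, star_intCast] at h'
  have hne : ζ - ζ ^ 2 ≠ 0 := by
    intro h0
    have h1 : ζ * (1 - ζ) = 0 := by linear_combination h0
    rcases mul_eq_zero.mp h1 with h2 | h2
    · exact hζ.ne_zero (by norm_num) h2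
    · exact hζ.ne_one (by norm_num) (by linear_combination -h2)
  have hbd : (b : ℂ) = d := by
    have : ((b : ℂ) - d) * (ζ - ζ ^ 2) = 0 := by linear_combination h - h'
    exact sub_eq_zero.mp ((mul_eq_zero.mp this).resolve_right hne)
  refine ⟨?_, by exact_mod_cast hbd⟩
  rw [hbd] at h
  exact_mod_cast add_right_cancel h

end Eisenstein

/-! ### Evaluation of the cubic Jacobi sum -/

namespace MulChar

variable {F : Type*} [Field F] [Fintype F] [DecidableEq F]

omit [DecidableEq F] in
lemma star_jacobiSum (χ ψ : MulChar F ℂ) : star (jacobiSum χ ψ) = jacobiSum χ⁻¹ ψ⁻¹ := by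
  simp only [jacobiSum, star_sum, star_mul', star_apply']

/-- Since `∑ χ = 0`, `η(1 - x)` may be replaced by `η(1 - x) - 1`, which is `0` or `-2` except at `x
= 1`, where it is `-1`. This congruence modulo 2 is what determines `χ 4`. -/
lemma exists_jacobiSum_quadratic_eq {χ : MulChar F ℂ} (hχ : χ ≠ 1) {ζ : ℂ}
    (hζ : IsPrimitiveRoot ζ 3) (hχ3 : χ ^ 3 = 1) :
    ∃ z ∈ Algebra.adjoin ℤ {ζ}, jacobiSum χ (quadratic F ℂ) = -1 + 2 * z := by
  have h : ∀ x : F, ∃ z ∈ Algebra.adjoin ℤ {ζ},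
      χ x * (quadratic F ℂ (1 - x) - 1) = -(if x = 1 then 1 else 0) + 2 * z := by
    intro x
    have hm := apply_mem_algebraAdjoin_of_pow_eq_one hχ3 hζ x
    rcases eq_or_ne x 1 with rfl | hx
    · exact ⟨0, Subalgebra.zero_mem _, by simp⟩
    rw [quadratic_apply]
    rcases quadraticChar_dichotomy (sub_ne_zero.mpr hx.symm) with h | h
    · exact ⟨0, Subalgebra.zero_mem _, by simp [h, hx]⟩
    · exact ⟨-χ x, Subalgebra.neg_mem _ hm, by simp [h, hx]; ring⟩
  choose z hz hzx using h
  refine ⟨∑ x, z x, Subalgebra.sum_mem _ fun x _ => hz x, ?_⟩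
  have h1 : jacobiSum χ (quadratic F ℂ) = ∑ x, χ x * (quadratic F ℂ (1 - x) - 1) := by
    simp only [mul_sub, mul_one, Finset.sum_sub_distrib, sum_eq_zero_of_ne_one hχ, sub_zero]
    rfl
  rw [h1, Finset.sum_congr rfl fun x _ => hzx x, Finset.sum_add_distrib, Finset.mul_sum]
  simp

/-- If `#F = 1 + 27 N ^ 2` is a prime with `N` even and `χ` is a cubic character of `F`, then
`2` is a cubic residue and the real part of `J(χ, χ)` is `-1`. -/
lemma apply_four_eq_one_and_jacobiSum_add {χ : MulChar F ℂ} (hχ : χ ≠ 1) (hχ3 : χ ^ 3 = 1)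
    {N : ℤ} (hN : (Fintype.card F : ℤ) = 1 + 27 * N ^ 2) (hNe : Even N)
    (hp : (Fintype.card F).Prime) :
    χ 4 = 1 ∧ jacobiSum χ χ + jacobiSum χ⁻¹ χ⁻¹ = -2 := by
  obtain ⟨ζ, hζ⟩ : ∃ ζ : ℂ, IsPrimitiveRoot ζ 3 := ⟨_, Complex.isPrimitiveRoot_exp 3 (by norm_num)⟩
  have hs := hζ.sq_add_add_one_eq_zero
  have hcardodd : Fintype.card F % 2 = 1 := by
    obtain ⟨k, hk⟩ := hNe
    have : (Fintype.card F : ℤ) = 1 + 2 * (54 * k ^ 2) := by rw [hN, hk]; ring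
    omega
  have hF : ringChar F ≠ 2 := fun h => by
    have := FiniteField.even_card_of_char_two h
    omega
  have h4 : (4 : F) ≠ 0 := by
    have : (4 : F) = 2 ^ 2 := by norm_num
    rw [this]
    exact pow_ne_zero _ (Ring.two_ne_zero hF)
  have hdvd : 3 ∣ Fintype.card F - 1 := by
    have := hp.one_lt
    zify [this.le]
    exact ⟨9 * N ^ 2, by rw [hN]; ring⟩
  obtain ⟨z, hz, hJ⟩ := exists_jacobiSum_eq_neg_one_add (by norm_num) hχ3 hχ3 hdvd hζ
  obtain ⟨c, d, rfl⟩ := hζ.mem_adjoin_iff_exists_int hz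
  -- Expansion of `-1 + (c + dζ)(ζ - 1)²`, where `(ζ - 1)² = -3ζ`.
  obtain ⟨a, b, ha, hb, hab⟩ : ∃ a b : ℤ, a = -1 + 3 * d ∧ b = 3 * (d - c) ∧
      jacobiSum χ χ = a + b * ζ := by
    refine ⟨_, _, rfl, rfl, ?_⟩
    rw [hJ]
    push_cast
    linear_combination (c + d * ζ - 3 * d) * hs
  have hconj : jacobiSum χ⁻¹ χ⁻¹ = a + b * ζ ^ 2 := by
    rw [← star_jacobiSum, hab]
    simp only [star_add, star_mul', hζ.conj_eq_sq, star_intCast]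
  have hχχ : χ * χ ≠ 1 := by
    intro h
    apply hχ
    rw [← hχ3, pow_succ, sq, h, one_mul]
  have hnorm : (Fintype.card F : ℤ) = a ^ 2 - a * b + b ^ 2 := by
    have h1 : ringChar ℂ ≠ ringChar F := by
      rw [ringChar.eq_zero]
      exact (CharP.ringChar_ne_zero_of_finite F).symm
    have h2 := jacobiSum_mul_jacobiSum_inv h1 hχ hχ hχχ
    rw [hab, hconj] at h2
    have : ((Fintype.card F : ℤ) : ℂ) = ((a ^ 2 - a * b + b ^ 2 : ℤ) : ℂ) := by
      push_cast
      rw [← h2]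
      linear_combination (a * b + b ^ 2 * ζ - b ^ 2) * hs
    exact_mod_cast this
  -- Here `4p = (2a - b)² + 3b²` with `b = 3(d - c)`.
  have hL : (2 * a - b) ^ 2 = 4 := by
    refine sq_eq_four_of_sq_add_twentyseven_mul_sq (M := d - c) (Nat.prime_iff_prime_int.mp hp)
      (by exact_mod_cast hp.pos) hN ?_
    rw [hnorm, hb]
    ring
  -- The value `2` is excluded because `2a - b ≡ -2` modulo 3.
  have hL' : 2 * a - b = -2 := by
    have h1 : (2 * a - b - 2) * (2 * a - b + 2) = 0 := by linear_combination hL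
    rcases mul_eq_zero.mp h1 with h2 | h2 <;> omega
  refine ⟨?_, ?_⟩
  · have hbe : b % 2 = 0 := by omega
    have hao : a % 2 = 1 := by
      have h1 : b = 2 * (a + 1) := by linarith
      have h2 : (Fintype.card F : ℤ) = 2 * (-a * (a + 1) + 2 * (a + 1) ^ 2) + a ^ 2 := by
        rw [hnorm, h1]
        ring
      have h3 : a ^ 2 % 2 = 1 := by omega
      rcases Int.emod_two_eq_zero_or_one a with h4 | h4
      · rw [sq, Int.mul_emod, h4] at h3
        omega
      · exact h4
    obtain ⟨w, hw, hq⟩ := exists_jacobiSum_quadratic_eq hχ hζ hχ3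
    obtain ⟨r, s, rfl⟩ := hζ.mem_adjoin_iff_exists_int hw
    have hdup := apply_four_mul_jacobiSum_self hF hχ
    rw [hq, hab] at hdup
    obtain ⟨k, hk, hk4⟩ := exists_apply_eq_pow hχ3 hζ h4
    rw [hk4] at hdup ⊢
    -- With `a` odd and `b` even, `ζ^k (a + bζ)` is congruent to `1` modulo 2 only for `k = 0`.
    interval_cases k
    · simp
    · have := hζ.int_add_int_mul_inj (a := -b) (b := a - b) (c := -1 + 2 * r) (d := 2 * s)
        (by push_cast; linear_combination hdup - b * hs)
      omega
    · have := hζ.int_add_int_mul_inj (a := b - a) (b := -a) (c := -1 + 2 * r) (d := 2 * s)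
        (by push_cast; linear_combination hdup - (b * ζ - b + a) * hs)
      omega
  · have h1 : (b : ℂ) = 2 * a + 2 := by
      have : b = 2 * a + 2 := by linarith
      exact_mod_cast this
    rw [hab, hconj]
    linear_combination b * hs - h1

end MulChar

/-! ### Counting outer differences of two sets -/

namespace DiffSystemOfSets

lemma outerDifferences_two {v : ℕ} (Q : Fin 2 → Finset (ZMod v)) :
    outerDifferences Q = (Q 0 ×ˢ Q 1).val.map (fun ab => ab.1 - ab.2) +
      (Q 1 ×ˢ Q 0).val.map (fun ab => ab.1 - ab.2) := by
  have h : (Finset.univ.filter fun ij : Fin 2 × Fin 2 => ij.1 ≠ ij.2) =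
      {((0 : Fin 2), (1 : Fin 2)), (1, 0)} := by decide
  rw [outerDifferences, h, Finset.insert_val_of_notMem (by decide), Finset.singleton_val,
    Multiset.cons_bind, Multiset.singleton_bind]

lemma count_map_sub {v : ℕ} [NeZero v] (A B : Finset (ZMod v)) (d : ZMod v) :
    ((A ×ˢ B).val.map fun ab => ab.1 - ab.2).count d =
      ∑ x : ZMod v, if x ∈ B ∧ x + d ∈ A then 1 else 0 := by
  rw [← Finset.card_filter, Multiset.count_map]
  change Finset.card (Finset.filter _ _) = _
  refine Finset.card_bij' (fun ab _ => ab.2) (fun x _ => (x + d, x)) ?_ ?_ ?_ ?_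
  · rintro ⟨a, b⟩ h
    simp only [Finset.mem_filter, Finset.mem_product, Finset.mem_univ, true_and] at h ⊢
    rw [h.2, add_sub_cancel]
    exact h.1.symm
  · intro x h
    simp only [Finset.mem_filter, Finset.mem_product, Finset.mem_univ, true_and] at h ⊢
    exact ⟨h.symm, by ring⟩
  · rintro ⟨a, b⟩ h
    simp only [Finset.mem_filter] at h
    ext <;> simp [h.2]
  · intro x _
    rfl

lemma redundancy_two {v : ℕ} {Q : Fin 2 → Finset (ZMod v)} (h : Disjoint (Q 0) (Q 1)) :
    redundancy Q = (Q 0).card + (Q 1).card := by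
  have : Finset.univ.biUnion Q = Q 0 ∪ Q 1 := by ext; simp
  rw [redundancy, this, Finset.card_union_of_disjoint h]

/-- Counting outer differences: two disjoint sets have `2 |Q 0| |Q 1|` of them. -/
lemma IsDSS.mul_pred_le {v ρ : ℕ} [NeZero v] {Q : Fin 2 → Finset (ZMod v)} (h : IsDSS ρ Q) :
    ρ * (v - 1) ≤ 2 * ((Q 0).card * (Q 1).card) := by
  have hcard : (outerDifferences Q).card = 2 * ((Q 0).card * (Q 1).card) := by
    rw [outerDifferences_two, Multiset.card_add, Multiset.card_map, Multiset.card_map,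
      Finset.card_val, Finset.card_val, Finset.card_product, Finset.card_product]
    ring
  calc ρ * (v - 1) = ∑ _d ∈ Finset.univ.erase (0 : ZMod v), ρ := by
        rw [Finset.sum_const, Finset.card_erase_of_mem (Finset.mem_univ _), Finset.card_univ,
          ZMod.card, smul_eq_mul, mul_comm]
    _ ≤ ∑ d ∈ Finset.univ.erase (0 : ZMod v), (outerDifferences Q).count d :=
        Finset.sum_le_sum fun d hd => h.le_count d (Finset.ne_of_mem_erase hd)
    _ ≤ ∑ d : ZMod v, (outerDifferences Q).count d :=
        Finset.sum_le_sum_of_subset (Finset.erase_subset _ _)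
    _ = 2 * ((Q 0).card * (Q 1).card) := by
        rw [Multiset.sum_count_eq_card fun a _ => Finset.mem_univ a, hcard]

/-! ### Cyclotomic classes and their indicator functions -/

section CyclotomicClass

variable {p : ℕ} [Fact p.Prime] {α : (ZMod p)ˣ}

lemma orderOf_of_forall_mem_zpowers (hα : ∀ x, x ∈ Subgroup.zpowers α) : orderOf α = p - 1 := by
  rw [orderOf_eq_card_of_forall_mem_zpowers hα, Nat.card_eq_fintype_card, ZMod.card_units]

lemma coe_pow_eq_coe_pow_iff (hα : ∀ x, x ∈ Subgroup.zpowers α) {k l : ℕ} :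
    (α : ZMod p) ^ k = (α : ZMod p) ^ l ↔ k ≡ l [MOD p - 1] := by
  rw [← Units.val_pow_eq_pow_val, ← Units.val_pow_eq_pow_val, Units.val_inj,
    pow_eq_pow_iff_modEq, orderOf_of_forall_mem_zpowers hα]

/-- Exponents matter modulo `p - 1`, and `f ∣ p - 1` makes their residue modulo `f` well defined. -/
lemma pow_mem_cyclotomicClass_iff (hα : ∀ x, x ∈ Subgroup.zpowers α) {f i k : ℕ}
    (hf : f ∣ p - 1) (hi : i < f) :
    (α : ZMod p) ^ k ∈ cyclotomicClass α f i ↔ k % f = i := by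
  have hp := (Fact.out : p.Prime).two_le
  simp only [cyclotomicClass, Finset.mem_image, Finset.mem_range, coe_pow_eq_coe_pow_iff hα]
  constructor
  · rintro ⟨t, -, h⟩
    have h' := h.of_dvd hf
    rw [← h', Nat.add_mul_mod_self_right, Nat.mod_eq_of_lt hi]
  · intro h
    have hlt : k % (p - 1) < p - 1 := Nat.mod_lt _ (by omega)
    have hm : k % (p - 1) % f = i := by rw [Nat.mod_mod_of_dvd _ hf, h]
    refine ⟨k % (p - 1) / f, Nat.div_lt_div_of_lt_of_dvd hf hlt, ?_⟩
    have : i + k % (p - 1) / f * f = k % (p - 1) := by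
      rw [← hm]
      exact Nat.mod_add_div' _ _
    rw [this]
    exact Nat.mod_modEq _ _

lemma zero_notMem_cyclotomicClass (f i : ℕ) : (0 : ZMod p) ∉ cyclotomicClass α f i := by
  simp only [cyclotomicClass, Finset.mem_image, not_exists, not_and]
  exact fun t _ => pow_ne_zero _ α.ne_zero

lemma exists_pow_eq (hα : ∀ x, x ∈ Subgroup.zpowers α) {x : ZMod p} (hx : x ≠ 0) :
    ∃ k : ℕ, (α : ZMod p) ^ k = x := by
  obtain ⟨k, hk⟩ := (mem_powers_iff_mem_zpowers (x := α)).mpr (hα (Units.mk0 x hx))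
  exact ⟨k, by simpa using congrArg Units.val hk⟩

lemma card_cyclotomicClass (hα : ∀ x, x ∈ Subgroup.zpowers α) {f i : ℕ}
    (hf : f ∣ p - 1) (hi : i < f) : (cyclotomicClass α f i).card = (p - 1) / f := by
  rw [cyclotomicClass, Finset.card_image_of_injOn, Finset.card_range]
  have hlt : ∀ t, t < (p - 1) / f → i + t * f < p - 1 := by
    intro t ht
    calc i + t * f < (t + 1) * f := by rw [add_mul, one_mul, add_comm]; omega
      _ ≤ (p - 1) / f * f := Nat.mul_le_mul_right _ ht
      _ = p - 1 := Nat.div_mul_cancel hf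
  intro s hs t ht h
  have h' := (coe_pow_eq_coe_pow_iff hα).mp h
  have h2 := h'.eq_of_lt_of_lt (hlt s (by simpa using hs)) (hlt t (by simpa using ht))
  exact Nat.eq_of_mul_eq_mul_right (by omega) (Nat.add_left_cancel h2)

lemma disjoint_cyclotomicClass (hα : ∀ x, x ∈ Subgroup.zpowers α) {f i j : ℕ}
    (hf : f ∣ p - 1) (hi : i < f) (hj : j < f) (hij : i ≠ j) :
    Disjoint (cyclotomicClass α f i) (cyclotomicClass α f j) := by
  rw [Finset.disjoint_left]
  intro x hxi hxj
  have hx : x ≠ 0 := fun h => zero_notMem_cyclotomicClass f i (h ▸ hxi)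
  obtain ⟨k, rfl⟩ := exists_pow_eq hα hx
  rw [pow_mem_cyclotomicClass_iff hα hf hi] at hxi
  rw [pow_mem_cyclotomicClass_iff hα hf hj] at hxj
  exact hij (hxi.symm.trans hxj)

lemma quadratic_apply_generator (hα : ∀ x, x ∈ Subgroup.zpowers α) (hp : p ≠ 2) :
    MulChar.quadratic (ZMod p) ℂ α = -1 := by
  have hF : ringChar (ZMod p) ≠ 2 := by rwa [ZMod.ringChar_zmod_n]
  rw [MulChar.quadratic_apply]
  rcases quadraticChar_dichotomy α.ne_zero with h | h
  · exact absurd ((MulChar.eq_iff hα (quadraticChar (ZMod p)) 1).mpr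
      (by rw [h, MulChar.one_apply_coe])) (quadraticChar_ne_one hF)
  · rw [h]
    simp

/-- There is a cubic character in terms of which the indicator functions of the classes `C_0^6`
and `C_3^6` are expressed by the sixth-order characters. -/
lemma exists_cubic_mulChar (hα : ∀ x, x ∈ Subgroup.zpowers α) (h6 : 6 ∣ p - 1) :
    ∃ χ : MulChar (ZMod p) ℂ, χ ≠ 1 ∧ χ ^ 3 = 1 ∧ ∀ x : ZMod p,
      (if x ∈ cyclotomicClass α 6 0 then 1 else 0 : ℂ) =
        ((1 : MulChar (ZMod p) ℂ) x + χ x + χ⁻¹ x) *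
          (1 + MulChar.quadratic (ZMod p) ℂ x) / 6 ∧
      (if x ∈ cyclotomicClass α 6 3 then 1 else 0 : ℂ) =
        ((1 : MulChar (ZMod p) ℂ) x + χ x + χ⁻¹ x) *
          (1 - MulChar.quadratic (ZMod p) ℂ x) / 6 := by
  have hp2 : p ≠ 2 := by
    rintro rfl
    norm_num at h6
  obtain ⟨ζ, hζ⟩ : ∃ ζ : ℂ, IsPrimitiveRoot ζ 3 := ⟨_, Complex.isPrimitiveRoot_exp 3 (by norm_num)⟩
  have hs := hζ.sq_add_add_one_eq_zero
  have h3 : ζ ^ 3 = 1 := hζ.pow_eq_one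
  have hu : (hζ.isUnit (by norm_num)).unit ∈ rootsOfUnity (Fintype.card (ZMod p)ˣ) ℂ := by
    rw [mem_rootsOfUnity', IsUnit.unit_spec, ZMod.card_units]
    obtain ⟨k, hk⟩ := h6
    rw [hk, show 6 * k = 3 * (2 * k) by ring, pow_mul, h3, one_pow]
  obtain ⟨χ, hχ⟩ : ∃ χ : MulChar (ZMod p) ℂ, χ α = ζ :=
    ⟨_, (MulChar.ofRootOfUnity_spec hu hα).trans (IsUnit.unit_spec _)⟩
  have hχ1 : χ ≠ 1 := by
    rintro rfl
    rw [MulChar.one_apply_coe] at hχ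
    exact hζ.ne_one (by norm_num) hχ.symm
  have hχ3 : χ ^ 3 = 1 := by
    rw [MulChar.eq_iff hα, MulChar.pow_apply_coe, hχ, h3, MulChar.one_apply_coe]
  have hinv : χ⁻¹ = χ ^ 2 := inv_eq_of_mul_eq_one_right (by rw [← pow_succ', hχ3])
  refine ⟨χ, hχ1, hχ3, fun x => ?_⟩
  -- The trivial character vanishes at 0, so both right-hand sides do too.
  rcases eq_or_ne x 0 with rfl | hx
  · simp only [zero_notMem_cyclotomicClass, MulChar.map_zero, if_false]
    norm_num
  obtain ⟨k, rfl⟩ := exists_pow_eq hα hx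
  simp only [pow_mem_cyclotomicClass_iff hα h6 (show 0 < 6 by norm_num),
    pow_mem_cyclotomicClass_iff hα h6 (show 3 < 6 by norm_num)]
  rw [hinv, MulChar.pow_apply' _ two_ne_zero,
    MulChar.one_apply hx.isUnit, map_pow, map_pow, hχ, quadratic_apply_generator hα hp2]
  have hk : k = 6 * (k / 6) + k % 6 := (Nat.div_add_mod k 6).symm
  have e1 : ζ ^ k = ζ ^ (k % 6) := by
    conv_lhs => rw [hk]
    rw [pow_add, show 6 * (k / 6) = 3 * (2 * (k / 6)) by ring, pow_mul, h3, one_pow, one_mul]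
  have e2 : (-1 : ℂ) ^ k = (-1) ^ (k % 6) := by
    conv_lhs => rw [hk]
    rw [pow_add, show 6 * (k / 6) = 2 * (3 * (k / 6)) by ring, pow_mul, neg_one_sq, one_pow,
      one_mul]
  rw [e1, e2]
  have hlt : k % 6 < 6 := Nat.mod_lt _ (by norm_num)
  have h4 : ζ ^ 4 = ζ := by rw [pow_succ, h3, one_mul]
  have h5 : ζ ^ 5 = ζ ^ 2 := by rw [pow_add ζ 3 2, h3, one_mul]
  have hn : 1 + ζ + ζ ^ 2 = 0 := by linear_combination hs
  have hn' : 1 + ζ ^ 2 + ζ = 0 := by linear_combination hs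
  -- `1 + ζ^k + ζ^(2k)` is 3 or 0 according to whether `3 ∣ k`; the factor `1 ± (-1)^k` selects the
  -- parity of `k`.
  interval_cases k % 6 <;> norm_num [h3, h4, h5, hn, hn', ← pow_mul]

end CyclotomicClass

end DiffSystemOfSets

/-! ### The sextic correlation and the perfect system -/

namespace DiffSystemOfSets

section CyclotomicClass

variable {p : ℕ} [Fact p.Prime] {α : (ZMod p)ˣ}

open MulChar in
/-- The correlation of the indicator functions of `C_0^6` and `C_3^6`, expanded in characters. -/
lemma sum_sextic_correlation {n : ℕ} (hp : p = 108 * n ^ 2 + 1) {χ : MulChar (ZMod p) ℂ}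
    (hχ : χ ≠ 1) (hχ3 : χ ^ 3 = 1) {d : ZMod p} (hd : d ≠ 0) :
    ∑ x : ZMod p, ((1 : MulChar (ZMod p) ℂ) x + χ x + χ⁻¹ x) *
      ((1 : MulChar (ZMod p) ℂ) (x + d) + χ (x + d) + χ⁻¹ (x + d)) *
        (1 - quadratic (ZMod p) ℂ x * quadratic (ZMod p) ℂ (x + d)) = 108 * n ^ 2 := by
  have hpp : p.Prime := Fact.out
  have hF : ringChar (ZMod p) ≠ 2 := by
    rw [ZMod.ringChar_zmod_n]
    omega
  set η := quadratic (ZMod p) ℂ with hη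
  have hηη : η * η = 1 := quadratic_mul_self
  have hη1 : η ≠ 1 := by
    rw [hη, quadratic, ringHomComp_ne_one_iff (RingHom.injective_int _)]
    exact quadraticChar_ne_one hF
  have hχχ : χ * χ = χ⁻¹ := by
    rw [eq_comm, inv_eq_iff_mul_eq_one, ← hχ3, pow_succ, sq, mul_comm]
  have hχi1 : χ⁻¹ ≠ 1 := inv_ne_one.mpr hχ
  have hχi3 : χ⁻¹ ^ 3 = 1 := by rw [inv_pow, hχ3, inv_one]
  have hne : ∀ ψ : MulChar (ZMod p) ℂ, ψ ≠ 1 → ψ ^ 3 = 1 → η * ψ ≠ 1 := by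
    intro ψ h1 h3 h
    have : ψ = η := by rw [← mul_one η, ← h, ← mul_assoc, hηη, one_mul]
    apply h1
    rw [← h3, this, pow_succ, sq, hηη, one_mul]
  obtain ⟨h4, hre⟩ := apply_four_eq_one_and_jacobiSum_add (N := 2 * n) hχ hχ3
    (by rw [ZMod.card, hp]; push_cast; ring) (even_two_mul _) (by rwa [ZMod.card])
  have h4' : χ⁻¹ 4 = 1 := by rw [inv_apply_eq_inv', h4, inv_one]
  have h40 : (2 : ZMod p) ≠ 0 := Ring.two_ne_zero hF
  have hη4 : η 4 = 1 := by
    rw [show (4 : ZMod p) = 2 ^ 2 by norm_num]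
    exact quadratic_apply_sq h40
  have hχn : χ (-1) = 1 := val_neg_one_eq_one_of_odd_order (n := 3) (by decide) hχ3
  have hχin : χ⁻¹ (-1) = 1 := val_neg_one_eq_one_of_odd_order (n := 3) (by decide) hχi3
  have hηn : η (-1) = 1 := by
    rw [hη, quadratic_apply, (quadraticChar_one_iff_isSquare (neg_ne_zero.mpr one_ne_zero)).mpr,
      Int.cast_one]
    rw [FiniteField.isSquare_neg_one_iff, ZMod.card]
    omega
  have h1n : (1 : MulChar (ZMod p) ℂ) (-1) = 1 := one_apply isUnit_one.neg
  have h1d : (1 : MulChar (ZMod p) ℂ) d = 1 := one_apply hd.isUnit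
  have hηd : η d * η d = 1 := by rw [← mul_apply, hηη, h1d]
  have hχd2 : χ d * χ d = χ⁻¹ d := by rw [← mul_apply, hχχ]
  have hχid2 : χ⁻¹ d * χ⁻¹ d = χ d := by rw [← mul_apply, ← mul_inv, hχχ, inv_inv]
  -- `χ`, `χ⁻¹` and `η` all take the value 1 at 4, so duplication loses its factor. Together with
  -- `hflip` it reduces the sextic sums to `J(χ, χ)` and `J(χ⁻¹, χ⁻¹)`.
  have hdup : ∀ ψ : MulChar (ZMod p) ℂ, ψ ≠ 1 → ψ 4 = 1 →
      jacobiSum ψ ψ = jacobiSum ψ η := by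
    intro ψ h1 h4
    rw [← apply_four_mul_jacobiSum_self hF h1, h4, one_mul]
  have hflip : ∀ ψ : MulChar (ZMod p) ℂ, jacobiSum (η * ψ) η = jacobiSum ψ⁻¹ η := by
    intro ψ
    rw [jacobiSum_eq_apply_neg_one_mul, hηn, one_mul, mul_right_comm, hηη, one_mul]
  have j11 : jacobiSum (1 : MulChar (ZMod p) ℂ) 1 = p - 2 := by
    rw [jacobiSum_one_one, ZMod.card]
  have j1a := jacobiSum_one_nontrivial hχ
  have j1b := jacobiSum_one_nontrivial hχi1
  have ja1 := (jacobiSum_comm χ 1).trans j1a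
  have jb1 := (jacobiSum_comm χ⁻¹ 1).trans j1b
  have jab : jacobiSum χ χ⁻¹ = -1 := by rw [jacobiSum_nontrivial_inv hχ, hχn]
  have jba := (jacobiSum_comm χ⁻¹ χ).trans jab
  have k11 : jacobiSum η η = -1 := by
    have h := jacobiSum_nontrivial_inv hη1
    rwa [hη, quadratic_inv, ← hη, hηn] at h
  have ka1 : jacobiSum (η * χ) η = jacobiSum χ⁻¹ χ⁻¹ := by rw [hflip, hdup _ hχi1 h4']
  have kb1 : jacobiSum (η * χ⁻¹) η = jacobiSum χ χ := by rw [hflip, inv_inv, hdup _ hχ h4]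
  have k1a := (jacobiSum_comm η (η * χ)).trans ka1
  have k1b := (jacobiSum_comm η (η * χ⁻¹)).trans kb1
  have kaa : jacobiSum (η * χ) (η * χ) = jacobiSum χ⁻¹ χ⁻¹ := by
    rw [hdup _ (hne _ hχ hχ3) (by rw [mul_apply, hη4, h4, one_mul]), ka1]
  have kbb : jacobiSum (η * χ⁻¹) (η * χ⁻¹) = jacobiSum χ χ := by
    rw [hdup _ (hne _ hχi1 hχi3) (by rw [mul_apply, hη4, h4', one_mul]), kb1]
  have kab : jacobiSum (η * χ) (η * χ⁻¹) = -1 := by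
    have : η * χ⁻¹ = (η * χ)⁻¹ := by rw [mul_inv, hη, quadratic_inv]
    rw [this, jacobiSum_nontrivial_inv (hne _ hχ hχ3), mul_apply, hηn, hχn, one_mul]
  have kba := (jacobiSum_comm (η * χ⁻¹) (η * χ)).trans kab
  have hηx : ∀ x : ZMod p, (1 : MulChar (ZMod p) ℂ) x * η x = η x := fun x => by
    rw [← mul_apply, one_mul]
  have hexp : ∀ x : ZMod p, ((1 : MulChar (ZMod p) ℂ) x + χ x + χ⁻¹ x) *
      ((1 : MulChar (ZMod p) ℂ) (x + d) + χ (x + d) + χ⁻¹ (x + d)) * (1 - η x * η (x + d)) =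
      ((1 : MulChar (ZMod p) ℂ) x * (1 : MulChar (ZMod p) ℂ) (x + d) +
        (1 : MulChar (ZMod p) ℂ) x * χ (x + d) + (1 : MulChar (ZMod p) ℂ) x * χ⁻¹ (x + d) +
        χ x * (1 : MulChar (ZMod p) ℂ) (x + d) + χ x * χ (x + d) + χ x * χ⁻¹ (x + d) +
        χ⁻¹ x * (1 : MulChar (ZMod p) ℂ) (x + d) + χ⁻¹ x * χ (x + d) + χ⁻¹ x * χ⁻¹ (x + d)) -
      (η x * η (x + d) + η x * (η * χ) (x + d) + η x * (η * χ⁻¹) (x + d) +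
        (η * χ) x * η (x + d) + (η * χ) x * (η * χ) (x + d) + (η * χ) x * (η * χ⁻¹) (x + d) +
        (η * χ⁻¹) x * η (x + d) + (η * χ⁻¹) x * (η * χ) (x + d) +
        (η * χ⁻¹) x * (η * χ⁻¹) (x + d)) := by
    intro x
    simp only [mul_apply]
    have h1 := hηx x
    have h2 := hηx (x + d)
    generalize (1 : MulChar (ZMod p) ℂ) x = a at *
    generalize (1 : MulChar (ZMod p) ℂ) (x + d) = b at *
    linear_combination -(b + χ (x + d) + χ⁻¹ (x + d)) * η (x + d) * h1 -
      (1 + χ x + χ⁻¹ x) * η x * h2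
  simp only [hexp, Finset.sum_add_distrib, Finset.sum_sub_distrib,
    sum_apply_mul_apply_add _ _ hd]
  simp only [mul_apply, h1n, hχn, hχin, hηn, h1d, one_mul, mul_one, j11, j1a, j1b, ja1, jb1, jab,
    jba, k11, ka1, kb1, k1a, k1b, kaa, kbb, kab, kba]
  have hpc : (p : ℂ) = 108 * n ^ 2 + 1 := by rw [hp]; push_cast; ring
  generalize jacobiSum χ χ = A at *
  generalize jacobiSum χ⁻¹ χ⁻¹ = B at *
  generalize η d = e at *
  generalize χ d = u at *
  generalize χ⁻¹ d = v at *
  -- Using `u² = v`, `v² = u` and `e² = 1`, the sum collapses to `p - 1 - (u + v)(A + B + 2)`.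
  linear_combination hpc - (u + v) * hre + (A - B) * hχd2 + (B - A) * hχid2 +
    (1 - 2 * u * B - 2 * v * A - u * u * B + 2 * u * v - v * v * A) * hηd

lemma count_outerDifferences_cyclotomicClass {n : ℕ} (hp : p = 108 * n ^ 2 + 1)
    (hα : ∀ x, x ∈ Subgroup.zpowers α) {d : ZMod p} (hd : d ≠ 0) :
    (outerDifferences ![cyclotomicClass α 6 0, cyclotomicClass α 6 3]).count d = 6 * n ^ 2 := by
  have h6 : 6 ∣ p - 1 := ⟨18 * n ^ 2, by omega⟩
  obtain ⟨χ, hχ, hχ3, hind⟩ := exists_cubic_mulChar hα h6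
  have hsum := sum_sextic_correlation hp hχ hχ3 hd
  rw [outerDifferences_two, Multiset.count_add]
  simp only [Matrix.cons_val_zero, Matrix.cons_val_one, count_map_sub, ← Finset.sum_add_distrib]
  -- `(1 - s)(1 + t) + (1 + s)(1 - t) = 2(1 - st)`, and `2 / 36 = 1 / 18`.
  have hterm : ∀ x : ZMod p,
      ((((if x ∈ cyclotomicClass α 6 3 ∧ x + d ∈ cyclotomicClass α 6 0 then 1 else 0) +
        (if x ∈ cyclotomicClass α 6 0 ∧ x + d ∈ cyclotomicClass α 6 3 then 1 else 0) : ℕ)) : ℂ) =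
      ((1 : MulChar (ZMod p) ℂ) x + χ x + χ⁻¹ x) *
      ((1 : MulChar (ZMod p) ℂ) (x + d) + χ (x + d) + χ⁻¹ (x + d)) *
        (1 - MulChar.quadratic (ZMod p) ℂ x * MulChar.quadratic (ZMod p) ℂ (x + d)) / 18 := by
    intro x
    push_cast
    simp only [ite_and]
    have h : ∀ P Q : Prop, ∀ [Decidable P] [Decidable Q],
        (if P then (if Q then 1 else 0) else 0 : ℂ) =
          (if P then 1 else 0) * (if Q then 1 else 0) := by
      intro P Q _ _
      split_ifs <;> simp
    rw [h, h, (hind x).1, (hind x).2, (hind (x + d)).1, (hind (x + d)).2]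
    ring
  have hC : ((∑ x : ZMod p,
      ((if x ∈ cyclotomicClass α 6 3 ∧ x + d ∈ cyclotomicClass α 6 0 then 1 else 0) +
        (if x ∈ cyclotomicClass α 6 0 ∧ x + d ∈ cyclotomicClass α 6 3 then 1 else 0)) : ℕ) : ℂ) =
      ((6 * n ^ 2 : ℕ) : ℂ) := by
    rw [Nat.cast_sum, Finset.sum_congr rfl fun x _ => hterm x, ← Finset.sum_div, hsum]
    push_cast
    ring
  exact_mod_cast hC

lemma isPerfectRegularDSS_cyclotomicClass {n : ℕ} (hp : p = 108 * n ^ 2 + 1)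
    (hα : ∀ x, x ∈ Subgroup.zpowers α) :
    IsPerfectRegularDSS p (18 * n ^ 2) 2 (6 * n ^ 2)
      ![cyclotomicClass α 6 0, cyclotomicClass α 6 3] := by
  have h6 : 6 ∣ p - 1 := ⟨18 * n ^ 2, by omega⟩
  have hdisj : Disjoint (cyclotomicClass α 6 0) (cyclotomicClass α 6 3) :=
    disjoint_cyclotomicClass hα h6 (by norm_num) (by norm_num) (by norm_num)
  have hcount := fun d hd => count_outerDifferences_cyclotomicClass (d := d) hp hα hd
  refine ⟨⟨⟨?_, fun d hd => (hcount d hd).ge⟩, hcount⟩, ?_⟩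
  · rw [Fin.forall_fin_two]
    simp only [Fin.forall_fin_two]
    exact ⟨⟨fun h => absurd rfl h, fun _ => hdisj⟩, fun _ => hdisj.symm, fun h => absurd rfl h⟩
  · rw [Fin.forall_fin_two]
    have : (p - 1) / 6 = 18 * n ^ 2 := by omega
    exact ⟨(card_cyclotomicClass hα h6 (by norm_num)).trans this,
      (card_cyclotomicClass hα h6 (by norm_num)).trans this⟩

end CyclotomicClass

/-! ### Optimality and the main theorem -/

lemma IsPerfectRegularDSS.redundancy_eq {v m ρ : ℕ} {Q : Fin 2 → Finset (ZMod v)}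
    (h : IsPerfectRegularDSS v m 2 ρ Q) : redundancy Q = 2 * m := by
  rw [redundancy_two (h.disjoint 0 1 (by decide)), h.card_eq, h.card_eq, two_mul]

/-- A perfect regular difference system of two sets is optimal: its sets have the least possible
sum of sizes for the product of sizes that the number of differences requires. -/
lemma IsPerfectRegularDSS.isOptimalDSS {v m ρ : ℕ} [NeZero v] {Q : Fin 2 → Finset (ZMod v)}
    (h : IsPerfectRegularDSS v m 2 ρ Q) (hm : 2 * m ^ 2 = ρ * (v - 1)) : IsOptimalDSS ρ Q := by
  refine ⟨h.toIsDSS, fun Q' hQ' => ?_⟩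
  have hle := hQ'.mul_pred_le
  rw [h.redundancy_eq, redundancy_two (hQ'.disjoint 0 1 (by decide))]
  rw [← hm] at hle
  -- Squares are compared: for set sizes `x`, `y` of `Q'`, `4m² ≤ 4xy ≤ (x + y)²`.
  refine (Nat.pow_le_pow_iff_left two_ne_zero).mp ?_
  zify at hle ⊢
  linarith [sq_nonneg (((Q' 0).card : ℤ) - (Q' 1).card)]

end DiffSystemOfSets

theorem mainTheorem5 (n : ℕ) (hp : Nat.Prime (108 * n ^ 2 + 1)) :
    (∃ Q : Fin 2 → Finset (ZMod (108 * n ^ 2 + 1)),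
      DiffSystemOfSets.IsPerfectRegularDSS (108 * n ^ 2 + 1) (18 * n ^ 2) 2 (6 * n ^ 2) Q) ∧
    ∀ α : (ZMod (108 * n ^ 2 + 1))ˣ, (∀ x, x ∈ Subgroup.zpowers α) →
      DiffSystemOfSets.IsPerfectRegularDSS (108 * n ^ 2 + 1) (18 * n ^ 2) 2 (6 * n ^ 2)
        ![DiffSystemOfSets.cyclotomicClass α 6 0, DiffSystemOfSets.cyclotomicClass α 6 3] ∧
      DiffSystemOfSets.IsOptimalDSS (6 * n ^ 2)
        ![DiffSystemOfSets.cyclotomicClass α 6 0, DiffSystemOfSets.cyclotomicClass α 6 3] ∧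
      DiffSystemOfSets.redundancyRate
        ![DiffSystemOfSets.cyclotomicClass α 6 0, DiffSystemOfSets.cyclotomicClass α 6 3] =
          36 * (n : ℚ) ^ 2 / (108 * (n : ℚ) ^ 2 + 1) ∧
      (36 * (n : ℚ) ^ 2 / (108 * (n : ℚ) ^ 2 + 1) =
          1 / 3 - 1 / (3 * (108 * (n : ℚ) ^ 2 + 1))) := by

  have hpp : Fact (108 * n ^ 2 + 1).Prime := ⟨hp⟩
  have key : ∀ α : (ZMod (108 * n ^ 2 + 1))ˣ, (∀ x, x ∈ Subgroup.zpowers α) →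
      DiffSystemOfSets.IsPerfectRegularDSS (108 * n ^ 2 + 1) (18 * n ^ 2) 2 (6 * n ^ 2)
        ![DiffSystemOfSets.cyclotomicClass α 6 0, DiffSystemOfSets.cyclotomicClass α 6 3] :=
    fun α hα => DiffSystemOfSets.isPerfectRegularDSS_cyclotomicClass rfl hα
  refine ⟨?_, fun α hα => ⟨key α hα, (key α hα).isOptimalDSS ?_, ?_, ?_⟩⟩
  · obtain ⟨α, hα⟩ := IsCyclic.exists_generator (α := (ZMod (108 * n ^ 2 + 1))ˣ)
    exact ⟨_, key α hα⟩
  · rw [Nat.add_sub_cancel]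
    ring
  · rw [DiffSystemOfSets.redundancyRate, (key α hα).redundancy_eq]
    push_cast
    ring
  · field_simp
    ring
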